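/- Let $F=\langle x,y\rangle$ be the free group of rank two and $\tau\colon F\to F$ the involution with $\tau(x)=x^{-1}$, $\tau(y)=y^{-1}$. Let $V=F_0\times F_1\times F_2$ with $F_i=\langle x_i,y_i\rangle$ free of rank two. Its three peripheral subgroups (indices mod 3) are $A_i=\langle a_i,b_i\rangle\cong F$, where $a_i=x_i^{-1}x_{i+1}$ and $b_i=y_i^{-1}y_{i+1}$. Let $T$ be a finite tree of valence at most $3$. Take a copy of $V$ for each vertex of $T$, using disjoint triples of indices for the different vertices, and assign distinct peripheral subgroups of that copy to the edges at the vertex. The group $V_T$ is obtained by amalgamating, for each edge of $T$, the two peripheral subgroups $A_i$, $A_j$ assigned to it via $\tau$, that is, by adding the relations $a_i=a_j^{-1}$, $b_i=b_j^{-1}$. The subgroups $A_i$ not assigned to any edge are the peripheral subgroups of $V_T$; denote them by $A_{\nu_0},\dots,A_{\nu_m}$ (in any order). The standard generators of $V_T$ are all the $x_i,y_i$ together with $a_{\nu_j},b_{\nu_j}$ for $j=0,\dots,m$. For a word $w$ in the standard generators and their inverses, let $|w|_x$ (respectively $|w|_y$) be the number of occurrences of letters $x_i^{\pm1}$ (respectively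 $y_i^{\pm1}$), over all $i$, and let $|w|_{\nu_j}$ be the number of occurrences of $a_{\nu_j}^{\pm1}$ and $b_{\nu_j}^{\pm1}$. **Proposition (balancing property).** Suppose that a word $w$ in the standard generators of $V_T$ and a reduced word $z(a_{\nu_0},b_{\nu_0})$ represent the same element of $A_{\nu_0}\subset V_T$. Then for each $i=1,\dots,m$ $$|z|\le |w|_{\nu_i}+|w|_{\nu_0}+|w|_x+|w|_y .$$ The same inequality holds for weighted lengths, $$\|z\|\le \|w\|_{\nu_i}+\|w\|_{\nu_0}+\|w\|_x+\|w\|_y ,$$ in which each occurrence of a letter $x_j^{\pm1}$ or $a_j^{\pm1}$ is counted with weight $d_1$ and each occurrence of a letter $y_j^{\pm1}$ or $b_j^{\pm1}$ with weight $d_2$. Here $(d_1,d_2)$ is any left eigenvector with positive entries, for an eigenvalue $\lambda>1$, of the transition matrix $$M_\phi=\begin{pmatrix}|\phi(x)|_x&|\phi(y)|_x\\|\phi(x)|_y&|\phi(y)|_y\end{pmatrix}$$ of any automorphism $\phi$ of $F$ that takes palindromic words to palindromic words and monotone words to monotone words. A word $u(x,y)$ is palindromic if $u(x^{-1},y^{-1})=u(x,y)^{-1}$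 in $F$, and monotone if it contains no inverse letters or only inverse letters; $|\phi(x)|_y$ is the number of occurrences of $y^{\pm1}$ in the reduced word $\phi(x)$, and similarly for the other entries. -/

import Mathlib

namespace BalancedTree

/-- The two letters of the standard basis of the free group `F = ⟨x, y⟩`. The letter `x` also
serves as the first letter `a` of a peripheral subgroup, and `y` as its second letter `b`. -/
inductive Gen
  | x
  | y
  deriving DecidableEq

instance : Fintype Gen := ⟨{Gen.x, Gen.y}, fun g => by cases g <;> simp⟩

/-- The free group of rank two. -/
abbrev F : Type := FreeGroup Gen

/-- The involution `τ` of `F` with `τ x = x⁻¹` and `τ y = y⁻¹`. -/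
def tau : F →* F := FreeGroup.lift fun g => (FreeGroup.of g)⁻¹

/-! ### The vertex group `V` and its peripheral subgroups -/

/-- The group `V = F₀ × F₁ × F₂`, with indices mod 3. -/
abbrev VertexGroup : Type := ZMod 3 → F

/-- The element `x_i` (for `g = x`) or `y_i` (for `g = y`) of `V`. -/
def factorGen (i : ZMod 3) (g : Gen) : VertexGroup := Pi.mulSingle i (FreeGroup.of g)

/-- The map `F → V` with `x ↦ a_i = x_i⁻¹ x_{i+1}` and `y ↦ b_i = y_i⁻¹ y_{i+1}`. It is injective
and its image is the peripheral subgroup `A_i` of `V`. -/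
def peripheralHom (i : ZMod 3) : F →* VertexGroup :=
  FreeGroup.lift fun g => (factorGen i g)⁻¹ * factorGen (i + 1) g

/-! ### The group `V_T` -/

/-- The choice, at every vertex of `T`, of distinct peripheral subgroups of the copy of `V` there
for the outgoing edges. The dart `e` is the edge from `e.fst` to `e.snd`, seen at `e.fst`, and
`side e` is the index of the peripheral subgroup assigned to it. Such a choice exists exactly
when every vertex of `T` has valence at most three. -/
structure EdgeAssignment {ι : Type*} (T : SimpleGraph ι) where
  side : T.Dart → ZMod 3
  side_injective : ∀ e f : T.Dart, e.fst = f.fst → side e = side f → e = f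

namespace EdgeAssignment

variable {ι : Type*} {T : SimpleGraph ι}

/-- The relators which amalgamate, for each edge, the two peripheral subgroups assigned to it
via `τ`. -/
def relators (s : EdgeAssignment T) : Set (Monoid.CoprodI fun _ : ι => VertexGroup) :=
  {r | ∃ (e : T.Dart) (g : F),
    r = Monoid.CoprodI.of (i := e.fst) (peripheralHom (s.side e) g) *
      (Monoid.CoprodI.of (i := e.snd) (peripheralHom (s.side e.symm) (tau g)))⁻¹}

/-- The group `V_T`: the free product of one copy of `V` for each vertex of the tree `T`, with
the peripheral subgroups amalgamated along the edges of `T`. -/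
abbrev VT (s : EdgeAssignment T) : Type _ :=
  (Monoid.CoprodI fun _ : ι => VertexGroup) ⧸ Subgroup.normalClosure s.relators

/-- The natural map from the copy of `V` at the vertex `v` to `V_T`. -/
def vertexHom (s : EdgeAssignment T) (v : ι) : VertexGroup →* s.VT :=
  (QuotientGroup.mk' (Subgroup.normalClosure s.relators)).comp
    (Monoid.CoprodI.of (M := fun _ : ι => VertexGroup) (i := v))

/-- The indices of the peripheral subgroups of `V_T`. The index `(v, c)` stands for member `c` of
the triple of indices at the vertex `v`; it is peripheral if the subgroup `A_c` of the copy
of `V` at `v` was not assigned to an edge of `T`. -/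
def PeripheralIndex (s : EdgeAssignment T) : Type _ :=
  {i : ι × ZMod 3 // ∀ e : T.Dart, (e.fst, s.side e) ≠ i}

/-- The names of the standard generators of `V_T`: all the `x_i` and `y_i`, and the generators
`a_i`, `b_i` of the peripheral subgroups only. -/
inductive StdGen (s : EdgeAssignment T)
  | factor (i : ι × ZMod 3) (g : Gen)
  | peripheral (i : s.PeripheralIndex) (g : Gen)

/-- The standard generators as elements of `V_T`. -/
def StdGen.val {s : EdgeAssignment T} : s.StdGen → s.VT
  | .factor i g => s.vertexHom i.1 (factorGen i.2 g)
  | .peripheral i g => s.vertexHom i.1.1 (peripheralHom i.1.2 (FreeGroup.of g))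

/-- Words in the standard generators of `V_T`, not necessarily reduced. The pair `(g, true)` is
the letter `g` and `(g, false)` is the letter `g⁻¹`. -/
abbrev StdWord (s : EdgeAssignment T) : Type _ := List (s.StdGen × Bool)

/-- The element of `V_T` represented by a word in the standard generators. -/
def StdWord.eval {s : EdgeAssignment T} (w : s.StdWord) : s.VT :=
  FreeGroup.lift StdGen.val (FreeGroup.mk w)

/-- The element `z(a_i, b_i)` of the peripheral subgroup `A_i` of `V_T`, for a word `z(x, y)`. -/
def peripheralEval (s : EdgeAssignment T) (i : s.PeripheralIndex) (z : List (Gen × Bool)) :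
    s.VT :=
  FreeGroup.lift (fun g => StdGen.val (.peripheral i g)) (FreeGroup.mk z)

end EdgeAssignment

/-! ### Lengths -/

open Classical in
/-- The number of letters `g` or `g⁻¹`, with `g` satisfying `P`, in a word. -/
noncomputable def occurrences {α : Type*} (P : α → Prop) (w : List (α × Bool)) : ℕ :=
  w.countP fun l => decide (P l.1)

namespace EdgeAssignment

variable {ι : Type*} {T : SimpleGraph ι} {s : EdgeAssignment T}

/-- `|w|_x` (for `g = x`) and `|w|_y` (for `g = y`): the number of occurrences of `x_i^{±1}`,
respectively of `y_i^{±1}`, for any index `i`. -/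
noncomputable def StdWord.factorLength (w : s.StdWord) (g : Gen) : ℕ :=
  occurrences (fun l => ∃ i, l = StdGen.factor i g) w

/-- `|w|_i`: the number of occurrences of `a_i^{±1}` and `b_i^{±1}`. -/
noncomputable def StdWord.peripheralLength (w : s.StdWord) (i : s.PeripheralIndex) : ℕ :=
  occurrences (fun l => ∃ g, l = StdGen.peripheral i g) w

/-- The weighted versions of `|w|_x` and `|w|_y`. -/
noncomputable def StdWord.weightedFactorLength (d : Gen → ℝ) (w : s.StdWord) (g : Gen) : ℝ :=
  d g * w.factorLength g

/-- The weighted version of `|w|_i`: the letter `a_i` has weight `d x` and `b_i` has weight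
`d y`. -/
noncomputable def StdWord.weightedPeripheralLength (d : Gen → ℝ) (w : s.StdWord)
    (i : s.PeripheralIndex) : ℝ :=
  ∑ g, d g * (occurrences (fun l => l = StdGen.peripheral i g) w : ℝ)

end EdgeAssignment

/-- The weighted length of a word in two letters and their inverses. -/
noncomputable def weightedLength (d : Gen → ℝ) (z : List (Gen × Bool)) : ℝ :=
  ∑ g, d g * (occurrences (fun l => l = g) z : ℝ)

/-! ### Monotone palindromic automorphisms and the weights -/

/-- An element of `F` is palindromic if `w(x⁻¹, y⁻¹) = w(x, y)⁻¹`. -/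
def IsPalindromic (w : F) : Prop := tau w = w⁻¹

/-- An element of `F` is monotone if its reduced word is positive or negative. -/
def IsMonotone (w : F) : Prop :=
  (∀ l ∈ w.toWord, l.2 = true) ∨ (∀ l ∈ w.toWord, l.2 = false)

/-- Automorphisms of `F` taking palindromic words to palindromic words. -/
def IsPalindromicAut (φ : F ≃* F) : Prop := ∀ w, IsPalindromic w → IsPalindromic (φ w)

/-- Automorphisms of `F` taking monotone words to monotone words. -/
def IsMonotoneAut (φ : F ≃* F) : Prop := ∀ w, IsMonotone w → IsMonotone (φ w)

/-- The transition matrix `M_φ`: the entry in row `l` and column `g` is the number of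
occurrences of `l^{±1}` in the reduced word `φ(g)`. -/
noncomputable def transitionMatrix (φ : F ≃* F) : Matrix Gen Gen ℝ :=
  Matrix.of fun l g => (occurrences (fun k => k = l) (φ (FreeGroup.of g)).toWord : ℝ)

/-- `d` is a left eigenvector, with positive entries, of the transition matrix for an eigenvalue
`lam > 1`. As the matrix is nonnegative, such a `lam` is its Perron-Frobenius eigenvalue. -/
structure IsWeightVector (φ : F ≃* F) (lam : ℝ) (d : Gen → ℝ) : Prop where
  one_lt : 1 < lam
  pos : ∀ g, 0 < d g
  left_eigenvector : Matrix.vecMul d (transitionMatrix φ) = lam • d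

end BalancedTree

/-!
The inequality is detected by a homomorphism `V_T → F` that kills every peripheral subgroup
except `A_{ν₀}` and `A_{νᵢ}`.

For a single copy of `V`, two distinct peripheral subgroups share exactly one of the three free
factors, and the projection of `V` to this factor is injective on both of them and kills the
third. For a tree, such projections, some of them twisted by `τ`, are used at the vertices of a
path which joins the vertices of `νᵢ` and `ν₀`, and the trivial map is used at all other vertices.
To fit the maps together it is convenient to record, for each vertex `v` and each index `c`, the
exponent `N (v, c) ∈ {-1, 0, 1}` such that `a_c ↦ x ^ N (v, c)` and `b_c ↦ y ^ N (v, c)`. Such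
exponents come from a map of the copy of `V` at `v` that factors through a projection exactly when
they sum to zero at `v` (`exists_eq_mul_sub`), and the relators are respected exactly when the
exponents at the two ends of each edge are opposite. So `N` is a unit flow along the path, with
its source and sink at the two peripheral subgroups (`exists_unitFlow`), and
`exists_hom_of_unitFlow` turns it into a homomorphism.

This homomorphism takes each standard generator to a letter with exponent `-1`, `0` or `1`, takes
`z(a_{ν₀}, b_{ν₀})` to `z`, and kills all peripheral generators outside `A_{ν₀}` and `A_{νᵢ}`.
Since free reduction only deletes letters, the occurrences of each of the letters `x`, `y` in `z`
are bounded separately by the occurrences in `w` of the standard generators over that letter. Both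
inequalities follow by summation, for arbitrary nonnegative weights.
-/

namespace BalancedTree

/-! ### Power endomorphisms of the free group -/

/-- The endomorphism of `F` with `x ↦ x ^ n` and `y ↦ y ^ n`. It is the identity for `n = 1`, the
involution `τ` for `n = -1` and trivial for `n = 0`. -/
def powHom (n : ℤ) : F →* F := FreeGroup.lift fun g => FreeGroup.of g ^ n

@[simp]
theorem powHom_of (n : ℤ) (g : Gen) : powHom n (FreeGroup.of g) = FreeGroup.of g ^ n := by
  simp [powHom]

theorem powHom_neg_tau (n : ℤ) (g : F) : powHom (-n) (tau g) = powHom n g := by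
  have h : (powHom (-n)).comp tau = powHom n := by
    ext g
    simp [tau]
  exact DFunLike.congr_fun h g

theorem powHom_comp_eval_peripheralHom (n : ℤ) (k c : ZMod 3) :
    ((powHom n).comp (Pi.evalMonoidHom _ k)).comp (peripheralHom c) =
      powHom (n * ((if k = c + 1 then 1 else 0) - if k = c then 1 else 0)) := by
  ext g
  have hc : c ≠ c + 1 := by revert c; decide
  by_cases h₁ : k = c + 1
  · subst h₁
    simp [peripheralHom, factorGen, hc.symm]
  · by_cases h₂ : k = c
    · subst h₂
      simp [peripheralHom, factorGen, h₁]
    · simp [peripheralHom, factorGen, h₁, h₂]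

/-! ### Unit flows between peripheral subgroups -/

/-- Exponents in `{-1, 0, 1}` with sum zero on the three peripheral subgroups of `V` are induced by
the projection to a single factor, followed by a power endomorphism. -/
theorem exists_eq_mul_sub (p : ZMod 3 → ℤ) (hp : ∀ c, |p c| ≤ 1) (hsum : ∑ c, p c = 0) :
    ∃ (k : ZMod 3) (n : ℤ), |n| ≤ 1 ∧
      ∀ c, p c = n * ((if k = c + 1 then 1 else 0) - if k = c then 1 else 0) := by
  have hsum' : p 0 + p 1 + p 2 = 0 := by
    rw [← hsum]
    exact (Fin.sum_univ_three p).symm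
  have h0 := abs_le.1 (hp 0)
  have h1 := abs_le.1 (hp 1)
  have h2 := abs_le.1 (hp 2)
  have key (k : ZMod 3) (n : ℤ) (hn : |n| ≤ 1)
      (e0 : p 0 = n * ((if k = 1 then 1 else 0) - if k = 0 then 1 else 0))
      (e1 : p 1 = n * ((if k = 2 then 1 else 0) - if k = 1 then 1 else 0))
      (e2 : p 2 = n * ((if k = 0 then 1 else 0) - if k = 2 then 1 else 0)) :
      ∃ (k : ZMod 3) (n : ℤ), |n| ≤ 1 ∧
        ∀ c, p c = n * ((if k = c + 1 then 1 else 0) - if k = c then 1 else 0) := by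
    refine ⟨k, n, hn, fun c => ?_⟩
    fin_cases c
    · exact e0
    · exact e1
    · exact e2
  have d01 : (0 : ZMod 3) ≠ 1 := by decide
  have d02 : (0 : ZMod 3) ≠ 2 := by decide
  have d12 : (1 : ZMod 3) ≠ 2 := by decide
  -- The factor is the one shared by the two peripheral subgroups with nonzero exponent.
  by_cases z0 : p 0 = 0
  · exact key 2 (p 1) (hp 1) (by simp [z0, d02.symm, d12.symm]) (by simp [d12.symm])
      (by simp [d02.symm]; omega)
  by_cases z1 : p 1 = 0
  · exact key 0 (p 2) (hp 2) (by simp [d01]; omega) (by simp [z1, d01, d02]) (by simp [d02])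
  · have z2 : p 2 = 0 := by omega
    exact key 1 (p 0) (hp 0) (by simp [d01.symm]) (by simp [d12]; omega)
      (by simp [z2, d01.symm, d12])

namespace EdgeAssignment

variable {ι : Type*} {T : SimpleGraph ι}

/-- The index of the peripheral subgroup assigned to an edge at its initial vertex. -/
def port (s : EdgeAssignment T) (e : T.Dart) : ι × ZMod 3 := (e.fst, s.side e)

theorem port_injective (s : EdgeAssignment T) : Function.Injective s.port := fun e f h =>
  s.side_injective e f (Prod.ext_iff.1 h).1 (Prod.ext_iff.1 h).2

theorem port_ne (s : EdgeAssignment T) (i : s.PeripheralIndex) (e : T.Dart) : s.port e ≠ i.1 :=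
  i.2 e

open Classical in
/-- The unit flow through a list of darts: every dart contributes `1` at its initial port and `-1`
at its terminal port. -/
noncomputable def dartFlow (s : EdgeAssignment T) (l : List T.Dart) : ι × ZMod 3 → ℤ :=
  (l.map fun e => Pi.single (s.port e) 1 - Pi.single (s.port e.symm) 1).sum

theorem dartFlow_apply_of_peripheral (s : EdgeAssignment T) (l : List T.Dart)
    (i : s.PeripheralIndex) : s.dartFlow l i.1 = 0 := by
  classical
  induction l with
  | nil => rfl
  | cons e l ih =>
    simp only [dartFlow, List.map_cons, List.sum_cons, Pi.add_apply, Pi.sub_apply] at ih ⊢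
    rw [ih, Pi.single_eq_of_ne (s.port_ne i e).symm, Pi.single_eq_of_ne (s.port_ne i e.symm).symm]
    simp

open Classical in
theorem dartFlow_port (s : EdgeAssignment T) (l : List T.Dart) (e : T.Dart) :
    s.dartFlow l (s.port e) = l.count e - l.count e.symm := by
  induction l with
  | nil => simp [dartFlow]
  | cons f l ih =>
    have hsymm : e = f.symm ↔ f = e.symm :=
      ⟨fun h => by rw [h, SimpleGraph.Dart.symm_symm],
        fun h => by rw [h, SimpleGraph.Dart.symm_symm]⟩
    simp only [dartFlow, List.map_cons, List.sum_cons, Pi.add_apply, Pi.sub_apply] at ih ⊢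
    rw [ih]
    simp only [Pi.single_apply, s.port_injective.eq_iff, List.count_cons, beq_iff_eq, hsymm,
      eq_comm (a := e) (b := f)]
    push_cast
    ring

theorem sum_single_apply [DecidableEq ι] (w : ι) (j : ι × ZMod 3) :
    ∑ c, (Pi.single j 1 : ι × ZMod 3 → ℤ) (w, c) = if w = j.1 then 1 else 0 := by
  obtain ⟨a, b⟩ := j
  by_cases h : w = a <;> simp [Pi.single_apply, h]

open Classical in
theorem sum_dartFlow_darts (s : EdgeAssignment T) {u v : ι} (p : T.Walk u v) (w : ι) :
    ∑ c, s.dartFlow p.darts (w, c) = (if w = u then 1 else 0) - if w = v then 1 else 0 := by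
  induction p with
  | nil => simp [dartFlow]
  | cons h p ih =>
    simp only [dartFlow, SimpleGraph.Walk.darts_cons, List.map_cons, List.sum_cons, Pi.add_apply,
      Pi.sub_apply, Finset.sum_add_distrib, Finset.sum_sub_distrib,
      sum_single_apply] at ih ⊢
    rw [ih]
    exact sub_add_sub_cancel _ _ _

/-- A unit flow on the peripheral subgroups of all the vertex groups, with sink `i` and source `j`
among the peripheral subgroups of `V_T`. Only the bound `abs_le_one` is recorded at the sink: it is
all that the count of letters uses. -/
structure IsUnitFlow (s : EdgeAssignment T) (i j : s.PeripheralIndex) (N : ι × ZMod 3 → ℤ) :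
    Prop where
  source : N j.1 = 1
  eq_zero : ∀ k : s.PeripheralIndex, k ≠ i → k ≠ j → N k.1 = 0
  symm : ∀ e, N (s.port e.symm) = -N (s.port e)
  sum_eq_zero : ∀ v, ∑ c, N (v, c) = 0
  abs_le_one : ∀ k, |N k| ≤ 1

theorem exists_unitFlow (s : EdgeAssignment T) (hT : T.Connected) {i j : s.PeripheralIndex}
    (hij : i ≠ j) : ∃ N, s.IsUnitFlow i j N := by
  classical
  obtain ⟨p, hp⟩ := hT.exists_isPath i.1.1 j.1.1
  have hport (e : T.Dart) : (s.dartFlow p.darts + Pi.single j.1 1 - Pi.single i.1 1 :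
      ι × ZMod 3 → ℤ) (s.port e) = p.darts.count e - p.darts.count e.symm := by
    simp [dartFlow_port, s.port_ne]
  have hper (k : s.PeripheralIndex) : (s.dartFlow p.darts + Pi.single j.1 1 - Pi.single i.1 1 :
      ι × ZMod 3 → ℤ) k.1 = (if k = j then 1 else 0) - if k = i then 1 else 0 := by
    have (l : s.PeripheralIndex) : k.1 = l.1 ↔ k = l := Subtype.ext_iff.symm
    simp [dartFlow_apply_of_peripheral, Pi.single_apply, this]
  refine ⟨s.dartFlow p.darts + Pi.single j.1 1 - Pi.single i.1 1, ?_, ?_, ?_, ?_, ?_⟩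
  · simp [hper, hij.symm]
  · intro k hi hj
    simp [hper, hi, hj]
  · intro e
    rw [hport, hport, SimpleGraph.Dart.symm_symm]
    ring
  · intro v
    simp only [Pi.add_apply, Pi.sub_apply, Finset.sum_add_distrib, Finset.sum_sub_distrib,
      sum_single_apply, sum_dartFlow_darts]
    ring
  · intro k
    by_cases hk : ∃ e, s.port e = k
    · obtain ⟨e, rfl⟩ := hk
      have hnodup : p.darts.Nodup := hp.isTrail.edges_nodup.of_map _
      have h₁ := List.nodup_iff_count_le_one.1 hnodup e
      have h₂ := List.nodup_iff_count_le_one.1 hnodup e.symm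
      rw [hport, abs_le]
      omega
    · obtain ⟨k, rfl⟩ : ∃ k' : s.PeripheralIndex, k'.1 = k := ⟨⟨k, fun e h => hk ⟨e, h⟩⟩, rfl⟩
      rw [hper]
      split_ifs <;> simp

/-! ### The homomorphism of a unit flow -/

/-- A unit flow is induced by a homomorphism `V_T → F` which takes each standard generator to a
power of its letter with exponent `-1`, `0` or `1`. -/
theorem exists_hom_of_unitFlow (s : EdgeAssignment T) {i j : s.PeripheralIndex}
    {N : ι × ZMod 3 → ℤ} (hN : s.IsUnitFlow i j N) :
    ∃ f : s.VT →* F,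
      (∀ k g, ∃ n : ℤ, |n| ≤ 1 ∧ f (StdGen.val (.factor k g)) = FreeGroup.of g ^ n) ∧
      ∀ k g, f (StdGen.val (.peripheral k g)) = FreeGroup.of g ^ N k.1 := by
  choose k n hn hkn using fun v =>
    exists_eq_mul_sub (fun c => N (v, c)) (fun c => hN.abs_le_one _) (hN.sum_eq_zero v)
  let h (v : ι) : VertexGroup →* F := (powHom (n v)).comp (Pi.evalMonoidHom _ (k v))
  have hper (v : ι) (c : ZMod 3) (g : F) : h v (peripheralHom c g) = powHom (N (v, c)) g := by
    rw [hkn v c, ← powHom_comp_eval_peripheralHom]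
    rfl
  have hker : Subgroup.normalClosure s.relators ≤ (Monoid.CoprodI.lift h).ker := by
    refine Subgroup.normalClosure_le_normal ?_
    rintro _ ⟨e, g, rfl⟩
    have hsymm : N (e.snd, s.side e.symm) = -N (e.fst, s.side e) := hN.symm e
    simp [MonoidHom.mem_ker, hper, hsymm, powHom_neg_tau]
  have hval (v : ι) (a : VertexGroup) :
      QuotientGroup.lift _ (Monoid.CoprodI.lift h) hker (s.vertexHom v a) = h v a := by
    simp [vertexHom]
  refine ⟨QuotientGroup.lift _ (Monoid.CoprodI.lift h) hker, fun c g => ?_, fun c g => ?_⟩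
  · simp only [StdGen.val, hval]
    by_cases hc : k c.1 = c.2
    · exact ⟨n c.1, hn _, by simp [h, factorGen, hc]⟩
    · exact ⟨0, by simp, by simp [h, factorGen, hc]⟩
  · simp only [StdGen.val, hval, hper, powHom_of]

end EdgeAssignment

/-! ### Counting letters -/

theorem occurrences_cons {α : Type*} (P : α → Prop) [DecidablePred P] (l : α × Bool)
    (w : List (α × Bool)) :
    occurrences P (l :: w) = occurrences P w + if P l.1 then 1 else 0 := by
  simp [occurrences, List.countP_cons]

theorem occurrences_toWord_mul_le (P : Gen → Prop) (u v : F) :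
    occurrences P (u * v).toWord ≤ occurrences P u.toWord + occurrences P v.toWord := by
  unfold occurrences
  rw [← List.countP_append]
  exact (FreeGroup.toWord_mul_sublist u v).countP_le

theorem occurrences_toWord_inv (P : Gen → Prop) (u : F) :
    occurrences P u⁻¹.toWord = occurrences P u.toWord := by
  unfold occurrences
  rw [FreeGroup.toWord_inv, FreeGroup.invRev, List.countP_reverse, List.countP_map]
  rfl

theorem occurrences_toWord_of_zpow_le (g g' : Gen) {n : ℤ} (hn : |n| ≤ 1) :
    occurrences (fun l => l = g) (FreeGroup.of g' ^ n).toWord ≤ if g' = g then 1 else 0 := by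
  have hof : occurrences (fun l => l = g) (FreeGroup.of g').toWord = if g' = g then 1 else 0 := by
    rw [FreeGroup.toWord_of, occurrences_cons]
    simp [occurrences]
  obtain rfl | rfl | rfl : n = -1 ∨ n = 0 ∨ n = 1 := by
    have := abs_le.1 hn
    omega
  · rw [zpow_neg_one, occurrences_toWord_inv, hof]
  · simp [occurrences]
  · rw [zpow_one, hof]

theorem length_eq_sum_occurrences (z : List (Gen × Bool)) :
    z.length = ∑ g, occurrences (fun l => l = g) z := by
  induction z with
  | nil => simp [occurrences]
  | cons l z ih => simp [occurrences_cons, Finset.sum_add_distrib, ih]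

theorem sum_gen {M : Type*} [AddCommMonoid M] (f : Gen → M) : ∑ g, f g = f .x + f .y := by
  rw [show (Finset.univ : Finset Gen) = {.x, .y} from rfl, Finset.sum_pair (by decide)]

namespace EdgeAssignment

variable {ι : Type*} {T : SimpleGraph ι} {s : EdgeAssignment T}

theorem StdWord.factorLength_cons (l : s.StdGen × Bool) (w : s.StdWord) (g : Gen)
    [Decidable (∃ k, l.1 = StdGen.factor k g)] :
    StdWord.factorLength (l :: w) g =
      StdWord.factorLength w g + if ∃ k, l.1 = StdGen.factor k g then 1 else 0 := by
  classical
  simp only [StdWord.factorLength, occurrences_cons]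
  congr

theorem StdWord.peripheralLength_eq_sum (w : s.StdWord) (k : s.PeripheralIndex) :
    w.peripheralLength k = ∑ g, occurrences (fun l => l = StdGen.peripheral k g) w := by
  classical
  induction w with
  | nil => simp [StdWord.peripheralLength, occurrences]
  | cons l w ih =>
    simp only [StdWord.peripheralLength] at ih
    simp only [StdWord.peripheralLength, occurrences_cons, Finset.sum_add_distrib, ih]
    obtain ⟨_ | ⟨k', g'⟩, b⟩ := l
    · simp
    · by_cases hk : k' = k <;> simp [hk]

/-- The occurrences of a letter in the image of `w` are bounded by the occurrences in `w` of the
standard generators over that letter that are not killed. -/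
theorem occurrences_toWord_map_eval_le {i j : s.PeripheralIndex} (hij : i ≠ j)
    {N : ι × ZMod 3 → ℤ} (hN : s.IsUnitFlow i j N) (f : s.VT →* F)
    (hfac : ∀ k g, ∃ n : ℤ, |n| ≤ 1 ∧ f (StdGen.val (.factor k g)) = FreeGroup.of g ^ n)
    (hper : ∀ k g, f (StdGen.val (.peripheral k g)) = FreeGroup.of g ^ N k.1)
    (w : s.StdWord) (g : Gen) :
    occurrences (fun l => l = g) (f w.eval).toWord ≤
      occurrences (fun l => l = StdGen.peripheral i g) w +
        occurrences (fun l => l = StdGen.peripheral j g) w + w.factorLength g := by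
  classical
  induction w with
  | nil => simp [StdWord.eval, occurrences, ← FreeGroup.one_eq_mk]
  | cons l w ih =>
    have hcons : f (StdWord.eval (l :: w)) =
        (cond l.2 (f l.1.val) (f l.1.val)⁻¹) * f (StdWord.eval w) := by
      obtain ⟨a, _ | _⟩ := l <;> simp [StdWord.eval, FreeGroup.lift_mk]
    have hinv : occurrences (fun l => l = g) (cond l.2 (f l.1.val) (f l.1.val)⁻¹).toWord =
        occurrences (fun l => l = g) (f l.1.val).toWord := by
      cases l.2
      · exact occurrences_toWord_inv _ _
      · rfl
    have hle := occurrences_toWord_mul_le (fun l => l = g)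
      (cond l.2 (f l.1.val) (f l.1.val)⁻¹) (f (StdWord.eval w))
    rw [← hcons, hinv] at hle
    rw [occurrences_cons, occurrences_cons, StdWord.factorLength_cons]
    suffices hl : occurrences (fun l => l = g) (f l.1.val).toWord ≤
        (if l.1 = StdGen.peripheral i g then 1 else 0) +
          (if l.1 = StdGen.peripheral j g then 1 else 0) +
            if ∃ k, l.1 = StdGen.factor k g then 1 else 0 by
      omega
    obtain ⟨⟨k, g'⟩ | ⟨k, g'⟩, b⟩ := l
    · obtain ⟨n, hn, hf⟩ := hfac k g'
      rw [hf]
      refine (occurrences_toWord_of_zpow_le g g' hn).trans ?_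
      simp
    · rw [hper]
      by_cases hki : k = i
      · refine (occurrences_toWord_of_zpow_le g g' (hN.abs_le_one _)).trans ?_
        simp [hki, hij]
      by_cases hkj : k = j
      · refine (occurrences_toWord_of_zpow_le g g' (hN.abs_le_one _)).trans ?_
        simp [hkj, hij.symm]
      · simp [hN.eq_zero k hki hkj, occurrences]

/-- The balancing property, letter by letter. -/
theorem occurrences_le_of_eval_eq_peripheralEval (hT : T.Connected) {i j : s.PeripheralIndex}
    (hij : i ≠ j) (w : s.StdWord) {z : List (Gen × Bool)} (hz : FreeGroup.IsReduced z)
    (hwz : w.eval = s.peripheralEval j z) (g : Gen) :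
    occurrences (fun l => l = g) z ≤
      occurrences (fun l => l = StdGen.peripheral i g) w +
        occurrences (fun l => l = StdGen.peripheral j g) w + w.factorLength g := by
  obtain ⟨N, hN⟩ := s.exists_unitFlow hT hij
  obtain ⟨f, hfac, hper⟩ := s.exists_hom_of_unitFlow hN
  have hid : f.comp (FreeGroup.lift fun g => StdGen.val (.peripheral j g)) = MonoidHom.id F := by
    ext g
    simp [hper, hN.source]
  have hfz : f w.eval = FreeGroup.mk z := by
    rw [hwz]
    exact DFunLike.congr_fun hid _
  have h := occurrences_toWord_map_eval_le hij hN f hfac hper w g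
  rwa [hfz, FreeGroup.toWord_mk, hz.reduce_eq] at h

end EdgeAssignment

end BalancedTree

theorem mainTheorem10 {ι : Type*} [Finite ι] (T : SimpleGraph ι) (hT : T.IsTree)
    (s : BalancedTree.EdgeAssignment T)
    (m : ℕ) (ν : Fin (m + 1) ≃ s.PeripheralIndex)
    (w : s.StdWord) (z : List (BalancedTree.Gen × Bool)) (hz : FreeGroup.IsReduced z)
    (hwz : w.eval = s.peripheralEval (ν 0) z) (i : Fin (m + 1)) (hi : i ≠ 0) :
    z.length ≤ w.peripheralLength (ν i) + w.peripheralLength (ν 0) +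
        w.factorLength BalancedTree.Gen.x + w.factorLength BalancedTree.Gen.y ∧
      ∀ (φ : BalancedTree.F ≃* BalancedTree.F) (lam : ℝ) (d : BalancedTree.Gen → ℝ),
        BalancedTree.IsPalindromicAut φ → BalancedTree.IsMonotoneAut φ →
        BalancedTree.IsWeightVector φ lam d →
        BalancedTree.weightedLength d z ≤
          w.weightedPeripheralLength d (ν i) + w.weightedPeripheralLength d (ν 0) +
            w.weightedFactorLength d BalancedTree.Gen.x +
            w.weightedFactorLength d BalancedTree.Gen.y := by
  have hle := BalancedTree.EdgeAssignment.occurrences_le_of_eval_eq_peripheralEval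
    hT.connected (ν.injective.ne hi) w hz hwz
  refine ⟨?_, fun φ lam d _ _ hd => ?_⟩
  · have hx := hle .x
    have hy := hle .y
    rw [BalancedTree.length_eq_sum_occurrences,
      BalancedTree.EdgeAssignment.StdWord.peripheralLength_eq_sum,
      BalancedTree.EdgeAssignment.StdWord.peripheralLength_eq_sum]
    simp only [BalancedTree.sum_gen]
    omega
  · have hmul (g : BalancedTree.Gen) :=
      mul_le_mul_of_nonneg_left (Nat.cast_le (α := ℝ).2 (hle g)) (hd.pos g).le
    have hx := hmul .x
    have hy := hmul .y
    push_cast at hx hy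
    simp only [BalancedTree.weightedLength,
      BalancedTree.EdgeAssignment.StdWord.weightedPeripheralLength,
      BalancedTree.EdgeAssignment.StdWord.weightedFactorLength, BalancedTree.sum_gen]
    linarith
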